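/- Let $k\geqslant 1$ and write $[k]=\{1,\ldots,k\}$. A \emph{$k$-configuration} is a map $\chi\colon \mathcal{P}([k])\setminus\{\varnothing\}\to\{0,1\}$. For subgroups $H_1,\ldots,H_k$ (possibly with repetitions) of a group $G$ and $\varnothing\neq I\subseteq[k]$, put $H_I=\bigcap_{i\in I}H_i$. The $k$-configuration $\chi$ is \emph{realizable} in $G$ if there are subgroups $H_1,\ldots,H_k\leqslant G$ such that, for every $\varnothing\neq I\subseteq[k]$, $\chi(I)=0$ if $H_I$ is finitely generated and $\chi(I)=1$ if $H_I$ is not finitely generated. Let $F_n$ denote the free group of rank $n$. \textbf{Theorem.} Let $k\geqslant 1$, let $\chi$ be a $k$-configuration, and let $m_\chi=\sum_{\chi(I)=1}(|I|-1)$, where the sum runs over the nonempty $I\subseteq[k]$ with $\chi(I)=1$. Then $\chi$ is realizable in $F_n\times\mathbb{Z}^m$ for every $n\geqslant 2$ and every $m\geqslant m_\chi$. In particular, for every $n\geqslant 2$ and for $m=m_\chi$, there exist subgroups $H_1,\ldots,H_k\leqslant F_n\times\mathbb{Z}^{m}$ such that, for every $\varnothing\neq I\subseteq[k]$, $H_I$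 is finitely generated if and only if $\chi(I)=0$. -/

import Mathlib

/-- The nonempty subsets of `[k]`, with `Fin k` as the `k`-element index set. -/
abbrev NonemptySubset (k : ℕ) : Type := {I : Finset (Fin k) // I.Nonempty}

/-- A `k`-configuration: a map from the nonempty subsets of `[k]` to `{0, 1}`. -/
abbrev Configuration (k : ℕ) : Type := NonemptySubset k → Fin 2

/-- The partial intersection `H_I = ⋂_{i ∈ I} H_i` of a family of subgroups. -/
def partialInter {G : Type*} [Group G] {k : ℕ} (H : Fin k → Subgroup G)
    (I : NonemptySubset k) : Subgroup G :=
  ⨅ i ∈ I.1, H i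

open Classical in
/-- The intersection configuration determined by a family of `k` subgroups:
`I` goes to `0` if `H_I` is finitely generated and to `1` otherwise. -/
noncomputable def intersectionConfiguration {G : Type*} [Group G] {k : ℕ}
    (H : Fin k → Subgroup G) : Configuration k :=
  fun I => if (partialInter H I).FG then 0 else 1

/-- A `k`-configuration is realizable in `G` if it is the intersection configuration
of some family of `k` subgroups of `G`. -/
def Configuration.IsRealizable {k : ℕ} (c : Configuration k) (G : Type*) [Group G] : Prop :=
  ∃ H : Fin k → Subgroup G, intersectionConfiguration H = c

/-- The group `F_n × ℤ^m` (the free-abelian factor written multiplicatively). -/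
abbrev FreeTimesFreeAbelian (n m : ℕ) : Type :=
  FreeGroup (Fin n) × Multiplicative (Fin m → ℤ)

/-- The number `∑_{c(I) = 1} (|I| - 1)`; the subtraction does not truncate, because every `I`
in the sum is nonempty. -/
def Configuration.supportRank {k : ℕ} (c : Configuration k) : ℕ :=
  ∑ I : NonemptySubset k with c I = 1, (I.1.card - 1)

/-!
The construction takes place in `FreeGroup X × ℤ^T` rather than in `F_n × ℤ^m`. Here `X` has two
letters `x_I`, `y_I` for every nonempty `I ⊆ [k]`, and `T` consists of the pairs `(I, i)` with
`c I = 1` and `i ∈ I` different from the smallest element of `I`, so that `|T|` is the support rank.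
Write `|w|_I` for the exponent sum of `y_I` in `w`. The subgroup `H_i` consists of the pairs `(w, v)`
such that `w` lies in the free factor spanned by the letters `x_I, y_I` with `i ∈ I`, and

* `v (I, i) = 0` whenever `(I, i) ∈ T`;
* `∑_j v (I, j) = |w|_I` whenever `c I = 1` and `i` is the smallest element of `I`.

So each `I` with `c I = 1` imposes `|I|` linear conditions, one for each `i ∈ I`. All of them together
force `|w|_I = 0`, while any proper subfamily can be solved for `v` with `w` arbitrary.
If `c J = 0`, the intersection `H_J` therefore projects onto the free factor spanned by the letters
of the `I ⊇ J`, there is a homomorphic section of this projection, and its kernel is a subgroup of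
`ℤ^T`; hence `H_J` is finitely generated (`partialInter_fg`). If `c J = 1`, every `(w, v) ∈ H_J` has
`|w|_J = 0`, and `H_J` contains the conjugates of `x_J` by the powers of `y_J`. Mapping `x_J` and
`y_J` to the generators of `FreeGroup ℤ ⋊ ℤ`, where `ℤ` acts by shifting the basis, and all other
letters to `1` carries `H_J` onto `FreeGroup ℤ`, which is not finitely generated
(`not_partialInter_fg`).

Realizability passes along injective homomorphisms (`Configuration.IsRealizable.of_injective`).
The semidirect product `FreeGroup ℤ ⋊ ℤ` also shows that the conjugates `y ^ i * x * y ^ (-i)` freely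
generate a subgroup of `F_n`, so `FreeGroup X` embeds in `F_n` for all `n ≥ 2`.
-/

/-! ### The group `FreeGroup ℤ ⋊ ℤ` -/

/-- The action of `ℤ` on `FreeGroup ℤ` that translates the basis. -/
def shiftAction : Multiplicative ℤ →* MulAut (FreeGroup ℤ) where
  toFun z := FreeGroup.freeGroupCongr (Equiv.addRight z.toAdd)
  map_one' := by
    have h : Equiv.addRight (0 : ℤ) = Equiv.refl ℤ := by ext; simp
    simp only [toAdd_one, h, FreeGroup.freeGroupCongr_refl]
    rfl
  map_mul' a b := by
    have h : Equiv.addRight (a * b).toAdd =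
        (Equiv.addRight b.toAdd).trans (Equiv.addRight a.toAdd) := by
      ext x; simp [add_comm, add_left_comm]
    rw [h, ← FreeGroup.freeGroupCongr_trans]
    rfl

theorem inr_zpow_conj_inl (i : ℤ) :
    (SemidirectProduct.inr (Multiplicative.ofAdd (1 : ℤ)) :
        FreeGroup ℤ ⋊[shiftAction] Multiplicative ℤ) ^ i *
      SemidirectProduct.inl (FreeGroup.of 0) *
      (SemidirectProduct.inr (Multiplicative.ofAdd (1 : ℤ))) ^ (-i) =
    SemidirectProduct.inl (FreeGroup.of i) := by
  have h : shiftAction (Multiplicative.ofAdd i) (FreeGroup.of 0) = FreeGroup.of i := by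
    simp [shiftAction]
  have hi : Multiplicative.ofAdd (1 : ℤ) ^ i = Multiplicative.ofAdd i := by
    rw [← ofAdd_zsmul, smul_eq_mul, mul_one]
  rw [← h, SemidirectProduct.inl_aut, zpow_neg, ← map_zpow SemidirectProduct.inr, hi, map_inv]

theorem not_fg_freeGroup_of_infinite (α : Type*) [Infinite α] : ¬ Group.FG (FreeGroup α) := by
  classical
  intro h
  let f : FreeGroup α →* Multiplicative (α →₀ ℤ) :=
    FreeGroup.lift fun a => Multiplicative.ofAdd (Finsupp.single a 1)
  have hf : Function.Surjective f := by
    rw [← MonoidHom.range_eq_top, eq_top_iff]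
    rintro v -
    induction v using Multiplicative.rec with | _ v
    induction v using Finsupp.induction_linear with
    | zero => exact one_mem _
    | add a b ha hb => exact mul_mem ha hb
    | single a z =>
      refine ⟨FreeGroup.of a ^ z, ?_⟩
      rw [map_zpow, FreeGroup.lift_apply_of, ← ofAdd_zsmul]
      simp
  have : Group.FG (Multiplicative (α →₀ ℤ)) := Group.fg_of_surjective hf
  have : AddGroup.FG (α →₀ ℤ) := AddGroup.fg_iff_mul_fg.2 this
  have : Module.Finite ℤ (α →₀ ℤ) := Module.Finite.iff_addGroup_fg.2 this
  have := Module.Finite.finite_basis (Finsupp.basisSingleOne (R := ℤ) (ι := α))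
  exact not_finite α

/-! ### Realizability and injective homomorphisms -/

/-- A free group on countably many letters embeds in `F_n` for `n ≥ 2`. -/
theorem exists_injective_freeGroup_hom (α : Type*) [Countable α] {n : ℕ} (hn : 2 ≤ n) :
    ∃ f : FreeGroup α →* FreeGroup (Fin n), Function.Injective f := by
  obtain ⟨e, he⟩ := exists_injective_nat α
  let x : Fin n := ⟨0, by omega⟩
  let y : Fin n := ⟨1, by omega⟩
  let g : FreeGroup ℤ →* FreeGroup (Fin n) :=
    FreeGroup.lift fun i => FreeGroup.of y ^ i * FreeGroup.of x * FreeGroup.of y ^ (-i)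
  let p : FreeGroup (Fin n) →* FreeGroup ℤ ⋊[shiftAction] Multiplicative ℤ :=
    FreeGroup.lift fun a => if a = x then SemidirectProduct.inl (FreeGroup.of 0)
      else SemidirectProduct.inr (Multiplicative.ofAdd 1)
  have hpg : p.comp g = SemidirectProduct.inl := by
    ext1 i
    have hyx : y ≠ x := by simp [x, y]
    rw [← inr_zpow_conj_inl i]
    simp [p, g, hyx]
  have hg : Function.Injective g := by
    have h : Function.Injective (p.comp g) := hpg ▸ SemidirectProduct.inl_injective
    exact Function.Injective.of_comp (f := p) h
  exact ⟨g.comp (FreeGroup.map fun a => (e a : ℤ)),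
    hg.comp (FreeGroup.map_injective (Nat.cast_injective.comp he))⟩

theorem mem_partialInter {G : Type*} [Group G] {k : ℕ} {H : Fin k → Subgroup G}
    {I : NonemptySubset k} {g : G} : g ∈ partialInter H I ↔ ∀ i ∈ I.1, g ∈ H i := by
  simp [partialInter, Subgroup.mem_iInf]

theorem intersectionConfiguration_eq_iff {G : Type*} [Group G] {k : ℕ} {H : Fin k → Subgroup G}
    {c : Configuration k} :
    intersectionConfiguration H = c ↔ ∀ I, (partialInter H I).FG ↔ c I = 0 := by
  rw [funext_iff]
  refine forall_congr' fun I => ?_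
  unfold intersectionConfiguration
  by_cases hI : (partialInter H I).FG <;>
    rcases Fin.exists_fin_two.1 ⟨c I, rfl⟩ with h | h <;> simp [h, hI]

theorem map_partialInter {G G' : Type*} [Group G] [Group G'] {f : G →* G'}
    (hf : Function.Injective f) {k : ℕ} (H : Fin k → Subgroup G) (I : NonemptySubset k) :
    partialInter (fun i => (H i).map f) I = (partialInter H I).map f := by
  have : Nonempty I.1 := I.2.to_subtype
  unfold partialInter
  rw [iInf_subtype', iInf_subtype', Subgroup.map_iInf f hf]

theorem Configuration.IsRealizable.of_injective {G G' : Type*} [Group G] [Group G'] {k : ℕ}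
    {c : Configuration k} (hc : c.IsRealizable G) {f : G →* G'} (hf : Function.Injective f) :
    c.IsRealizable G' := by
  obtain ⟨H, hH⟩ := hc
  refine ⟨fun i => (H i).map f, intersectionConfiguration_eq_iff.2 fun I => ?_⟩
  rw [map_partialInter hf, ← intersectionConfiguration_eq_iff.1 hH I]
  rw [← Group.fg_iff_subgroup_fg, ← Group.fg_iff_subgroup_fg]
  let e := (partialInter H I).equivMapOfInjective f hf
  exact ⟨fun _ => Group.fg_of_surjective (f := e.symm.toMonoidHom) e.symm.surjective,
    fun _ => Group.fg_of_surjective (f := e.toMonoidHom) e.surjective⟩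

/-! ### Free factors spanned by letters -/

open Classical in
/-- The retraction of a free group onto the free factor spanned by the letters in `A`: it kills
all other letters. The free factor itself is the set of fixed points. -/
noncomputable def letterRetraction {α : Type*} (A : Set α) : FreeGroup α →* FreeGroup α :=
  FreeGroup.lift fun a => if a ∈ A then FreeGroup.of a else 1

theorem letterRetraction_of_mem {α : Type*} {A : Set α} {a : α} (h : a ∈ A) :
    letterRetraction A (FreeGroup.of a) = FreeGroup.of a := by
  simp [letterRetraction, h]

theorem letterRetraction_comp {α : Type*} (A B : Set α) (w : FreeGroup α) :
    letterRetraction A (letterRetraction B w) = letterRetraction (A ∩ B) w := by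
  have : (letterRetraction A).comp (letterRetraction B) = letterRetraction (A ∩ B) := by
    ext a
    by_cases hA : a ∈ A <;> by_cases hB : a ∈ B <;> simp [letterRetraction, hA, hB]
  exact DFunLike.congr_fun this w

theorem letterRetraction_iInter {α ι : Type*} (A : ι → Set α) (s : Finset ι) {w : FreeGroup α}
    (h : ∀ i ∈ s, letterRetraction (A i) w = w) :
    letterRetraction {a | ∀ i ∈ s, a ∈ A i} w = w := by
  classical
  induction s using Finset.induction_on with
  | empty =>
    have : letterRetraction {a : α | ∀ i ∈ (∅ : Finset ι), a ∈ A i} = MonoidHom.id _ := by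
      ext a; simp [letterRetraction]
    rw [this]; rfl
  | insert i s _ ih =>
    have hs : {a | ∀ j ∈ insert i s, a ∈ A j} = A i ∩ {a | ∀ j ∈ s, a ∈ A j} := by
      ext a; simp
    rw [hs, ← letterRetraction_comp, ih fun j hj => h j (Finset.mem_insert_of_mem hj),
      h i (Finset.mem_insert_self i s)]

/-- The sum of the exponents of the letter `a`. -/
noncomputable def exponentSum {α : Type*} (a : α) : FreeGroup α →* Multiplicative ℤ :=
  open Classical in FreeGroup.lift fun b => if b = a then Multiplicative.ofAdd 1 else 1

theorem exponentSum_letterRetraction_of_notMem {α : Type*} {A : Set α} {a : α} (h : a ∉ A)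
    (w : FreeGroup α) : exponentSum a (letterRetraction A w) = 1 := by
  have : (exponentSum a).comp (letterRetraction A) = 1 := by
    ext b
    by_cases hb : b ∈ A
    · have : b ≠ a := fun e => h (e ▸ hb)
      simp [letterRetraction, exponentSum, hb, this]
    · simp [letterRetraction, hb]
  exact DFunLike.congr_fun this w

/-! ### The subgroups -/

/-- The letters: `(I, false)` stands for `x_I` and `(I, true)` for `y_I`. -/
abbrev Letter (k : ℕ) : Type := NonemptySubset k × Bool

namespace Configuration

variable {k : ℕ} (c : Configuration k)

/-- The coordinates of the free-abelian factor: pairs `(I, i)` with `c I = 1` and `i ∈ I` not the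
smallest element of `I`. -/
def coordinates : Finset ((_ : NonemptySubset k) × Fin k) :=
  (Finset.univ.filter fun I : NonemptySubset k => c I = 1).sigma fun I => I.1.erase (I.1.min' I.2)

theorem card_coordinates : c.coordinates.card = c.supportRank := by
  rw [coordinates, Finset.card_sigma, supportRank]
  exact Finset.sum_congr rfl fun I _ => Finset.card_erase_of_mem (Finset.min'_mem _ _)

variable {c} in
theorem mem_coordinates {I : NonemptySubset k} {i : Fin k} :
    (⟨I, i⟩ : (_ : NonemptySubset k) × Fin k) ∈ c.coordinates ↔
      c I = 1 ∧ i ≠ I.1.min' I.2 ∧ i ∈ I.1 := by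
  simp [coordinates]

/-- The free times free-abelian group in which the configuration is realized. -/
abbrev Ambient : Type := FreeGroup (Letter k) × Multiplicative (c.coordinates → ℤ)

/-- The letters `x_I`, `y_I` with `i ∈ I`. -/
def letters (i : Fin k) : Set (Letter k) := {a | i ∈ a.1.1}

/-- The sum of the coordinates that belong to `I`. -/
def blockSum (I : NonemptySubset k) : Multiplicative (c.coordinates → ℤ) →* Multiplicative ℤ :=
  AddMonoidHom.toMultiplicative
    { toFun := fun v => ∑ t : c.coordinates with t.1.1 = I, v t
      map_zero' := by simp
      map_add' := fun v w => by simp [Finset.sum_add_distrib] }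

theorem toAdd_blockSum (I : NonemptySubset k) (v : Multiplicative (c.coordinates → ℤ)) :
    (c.blockSum I v).toAdd = ∑ t : c.coordinates with t.1.1 = I, v.toAdd t := rfl

/-- The pairs `(w, v)` with `w` in the free factor of the letters indexed by sets containing `i`,
where `v` satisfies the linear condition that each `I ∋ i` with `c I = 1` attaches to `i`. -/
noncomputable def member (i : Fin k) : Subgroup c.Ambient where
  carrier := {p | letterRetraction (letters i) p.1 = p.1 ∧
    (∀ t : c.coordinates, t.1.2 = i → p.2.toAdd t = 0) ∧
    ∀ I : NonemptySubset k, c I = 1 → I.1.min' I.2 = i →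
      c.blockSum I p.2 = exponentSum (I, true) p.1}
  one_mem' := by simp
  mul_mem' := by
    rintro p q ⟨h₁, h₂, h₃⟩ ⟨h₁', h₂', h₃'⟩
    refine ⟨by simp [h₁, h₁'], fun t ht => by simp [h₂ t ht, h₂' t ht], fun I hI hi => ?_⟩
    simp [h₃ I hI hi, h₃' I hI hi]
  inv_mem' := by
    rintro p ⟨h₁, h₂, h₃⟩
    refine ⟨by simp [h₁], fun t ht => by simp [h₂ t ht], fun I hI hi => ?_⟩
    simp [h₃ I hI hi]

theorem mem_member {i : Fin k} {p : c.Ambient} : p ∈ c.member i ↔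
    letterRetraction (letters i) p.1 = p.1 ∧
    (∀ t : c.coordinates, t.1.2 = i → p.2.toAdd t = 0) ∧
    ∀ I : NonemptySubset k, c I = 1 → I.1.min' I.2 = i →
      c.blockSum I p.2 = exponentSum (I, true) p.1 := Iff.rfl

/-! ### Intersections that are finitely generated -/

/-- The homomorphism that solves the linear conditions for given `w`: in the block of `I`, the
coordinate `j I` takes the value `|w|_I`, and all others vanish. -/
noncomputable def solution (j : NonemptySubset k → Fin k) :
    FreeGroup (Letter k) →* Multiplicative (c.coordinates → ℤ) where
  toFun w := Multiplicative.ofAdd fun t =>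
    if t.1.2 = j t.1.1 then (exponentSum (t.1.1, true) w).toAdd else 0
  map_one' := by ext t; simp
  map_mul' v w := by
    rw [← ofAdd_add]
    congr 1
    ext t
    by_cases h : t.1.2 = j t.1.1 <;> simp [h]

theorem toAdd_solution (j : NonemptySubset k → Fin k) (w : FreeGroup (Letter k))
    (t : c.coordinates) : (c.solution j w).toAdd t =
      if t.1.2 = j t.1.1 then (exponentSum (t.1.1, true) w).toAdd else 0 := rfl

theorem blockSum_solution {j : NonemptySubset k → Fin k} {I : NonemptySubset k} (hI : c I = 1)
    (hj : j I ∈ I.1) (hj' : j I ≠ I.1.min' I.2) (w : FreeGroup (Letter k)) :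
    c.blockSum I (c.solution j w) = exponentSum (I, true) w := by
  apply Multiplicative.toAdd.injective
  rw [toAdd_blockSum,
    Finset.sum_eq_single (⟨⟨I, j I⟩, mem_coordinates.2 ⟨hI, hj', hj⟩⟩ : c.coordinates)]
  · simp [toAdd_solution]
  · rintro ⟨⟨I', i⟩, ht⟩ h hne
    obtain rfl : I' = I := by simpa using h
    have : i ≠ j I' := fun e => hne (by subst e; rfl)
    simp [toAdd_solution, this]
  · simp

/-- If `j I` lies in `I` but not in `J` for all `I ⊇ J` with `c I = 1`, then the solution belonging
to `j` is a section over the free factor of the letters indexed by the `I ⊇ J`. -/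
theorem section_mem_partialInter {J : NonemptySubset k} {j : NonemptySubset k → Fin k}
    (hj : ∀ I, c I = 1 → J.1 ⊆ I.1 → j I ∈ I.1 ∧ j I ∉ J.1) {w : FreeGroup (Letter k)}
    (hw : letterRetraction {a | ∀ i ∈ J.1, a ∈ letters i} w = w) :
    ((w, c.solution j w) : c.Ambient) ∈ partialInter c.member J := by
  have hexp : ∀ I : NonemptySubset k, ¬ J.1 ⊆ I.1 → exponentSum (I, true) w = 1 := by
    intro I hI
    rw [← hw]
    exact exponentSum_letterRetraction_of_notMem (fun h => hI h) w
  refine mem_partialInter.2 fun i hi => (mem_member c).2 ⟨?_, fun t ht => ?_, fun I hI hmin => ?_⟩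
  · change letterRetraction (letters i) w = w
    conv_lhs => rw [← hw]
    have hsub : {a : Letter k | ∀ i ∈ J.1, a ∈ letters i} ⊆ letters i := fun a ha => ha i hi
    rw [letterRetraction_comp, Set.inter_eq_right.2 hsub, hw]
  · rw [toAdd_solution]
    split_ifs with h
    · by_cases hJ : J.1 ⊆ t.1.1.1
      · exact absurd (h ▸ ht ▸ hi) (hj _ (mem_coordinates.1 t.2).1 hJ).2
      · simp [hexp _ hJ]
    · rfl
  · by_cases hJ : J.1 ⊆ I.1
    · obtain ⟨h₁, h₂⟩ := hj I hI hJ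
      exact c.blockSum_solution hI h₁ (fun e => h₂ (by rw [e, hmin]; exact hi)) w
    · apply Multiplicative.toAdd.injective
      rw [toAdd_blockSum, hexp I hJ]
      refine Finset.sum_eq_zero fun t ht => ?_
      have : t.1.1 = I := by simpa using ht
      simp [toAdd_solution, this, hexp I hJ]

theorem partialInter_fg {J : NonemptySubset k} (hJ : c J = 0) :
    (partialInter c.member J).FG := by
  have hex : ∀ I : NonemptySubset k, ∃ i, c I = 1 → J.1 ⊆ I.1 → i ∈ I.1 ∧ i ∉ J.1 := by
    intro I
    by_cases h : c I = 1 ∧ J.1 ⊆ I.1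
    · have hne : ¬ I.1 ⊆ J.1 := fun h' => by
        have : J = I := Subtype.ext (h.2.antisymm h')
        rw [← this, hJ] at h
        exact absurd h.1 (by decide)
      obtain ⟨i, hi⟩ := Finset.not_subset.1 hne
      exact ⟨i, fun _ _ => hi⟩
    · exact ⟨J.1.min' J.2, fun h₁ h₂ => absurd ⟨h₁, h₂⟩ h⟩
  choose j hj using hex
  set r := letterRetraction {a : Letter k | ∀ i ∈ J.1, a ∈ letters i} with hr
  have hrr : ∀ w, r (r w) = r w := fun w => by
    rw [hr, letterRetraction_comp, Set.inter_self]
  let σ : FreeGroup (Letter k) →* c.Ambient := (r.prod ((c.solution j).comp r))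
  have hσ : σ.range ≤ partialInter c.member J := by
    rintro _ ⟨w, rfl⟩
    exact c.section_mem_partialInter hj (hrr w)
  -- The intersection is the product of a section of its projection to the free group and of
  -- the kernel of that projection.
  let ι : Multiplicative (c.coordinates → ℤ) →* c.Ambient := MonoidHom.inr _ _
  let N := (partialInter c.member J).comap ι
  have hdecomp : partialInter c.member J = σ.range ⊔ N.map ι := by
    apply le_antisymm
    · rintro ⟨w, v⟩ hp
      have hw : r w = w := letterRetraction_iInter _ _ fun i hi =>
        ((mem_member c).1 (mem_partialInter.1 hp i hi)).1
      have hs : (w, c.solution j w) ∈ σ.range := ⟨w, by simp [σ, hw]⟩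
      have hsplit : ((w, v) : c.Ambient) =
          (w, c.solution j w) * ι ((c.solution j w)⁻¹ * v) := by
        simp [ι]
      have hk : ι ((c.solution j w)⁻¹ * v) ∈ partialInter c.member J := by
        have := mul_mem (inv_mem (hσ hs)) hp
        rwa [hsplit, inv_mul_cancel_left] at this
      rw [hsplit]
      exact mul_mem (Subgroup.mem_sup_left hs)
        (Subgroup.mem_sup_right (Subgroup.mem_map_of_mem ι hk))
    · exact sup_le hσ (Subgroup.map_comap_le _ _)
  rw [hdecomp]
  have hN : N.FG := by
    rw [Subgroup.fg_iff_add_fg]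
    have := IsNoetherian.noetherian (AddSubgroup.toIntSubmodule
      (N.toAddSubgroup : AddSubgroup (c.coordinates → ℤ)))
    rwa [Submodule.fg_iff_addSubgroup_fg] at this
  refine Subgroup.FG.sup ((Group.fg_iff_subgroup_fg _).1 inferInstance) ?_
  have : Group.FG N := (Group.fg_iff_subgroup_fg _).2 hN
  exact (Group.fg_iff_subgroup_fg _).1
    (Group.fg_of_surjective (ι.subgroupMap_surjective N))

/-! ### Intersections that are not finitely generated -/

theorem exponentSum_eq_one_of_mem_partialInter {J : NonemptySubset k} (hJ : c J = 1)
    {p : c.Ambient} (hp : p ∈ partialInter c.member J) : exponentSum (J, true) p.1 = 1 := by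
  have hmin := (mem_member c).1 (mem_partialInter.1 hp _ (J.1.min'_mem J.2))
  rw [← hmin.2.2 J hJ rfl]
  apply Multiplicative.toAdd.injective
  rw [toAdd_blockSum]
  refine Finset.sum_eq_zero fun t ht => ?_
  have htJ : t.1.1 = J := by simpa using ht
  have hmem : t.1.2 ∈ J.1 := htJ ▸ (mem_coordinates.1 t.2).2.2
  exact ((mem_member c).1 (mem_partialInter.1 hp _ hmem)).2.1 t rfl

theorem conj_mem_partialInter (J : NonemptySubset k) (z : ℤ) :
    ((FreeGroup.of (J, true) ^ z * FreeGroup.of (J, false) * FreeGroup.of (J, true) ^ (-z), 1) :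
      c.Ambient) ∈ partialInter c.member J := by
  refine mem_partialInter.2 fun i hi => (mem_member c).2 ⟨?_, fun t _ => rfl, fun I _ _ => ?_⟩
  · have h : ∀ b, ((J, b) : Letter k) ∈ letters i := fun b => hi
    simp [letterRetraction_of_mem (h _)]
  · have : exponentSum (I, true) (FreeGroup.of (J, false)) = 1 := by simp [exponentSum]
    simp [this]

/-- The homomorphism to `FreeGroup ℤ ⋊ ℤ` that sends `x_J` to the letter `0`, `y_J` to the shift,
and all other letters to `1`. -/
noncomputable def toShift (J : NonemptySubset k) :
    FreeGroup (Letter k) →* FreeGroup ℤ ⋊[shiftAction] Multiplicative ℤ :=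
  FreeGroup.lift fun a =>
    if a = (J, false) then SemidirectProduct.inl (FreeGroup.of 0)
    else if a = (J, true) then SemidirectProduct.inr (Multiplicative.ofAdd 1) else 1

theorem rightHom_toShift (J : NonemptySubset k) (w : FreeGroup (Letter k)) :
    SemidirectProduct.rightHom (toShift J w) = exponentSum (J, true) w := by
  have : SemidirectProduct.rightHom.comp (toShift J) = exponentSum (J, true) := by
    ext1 a
    by_cases h : a = (J, false)
    · simp [toShift, exponentSum, h]
    · by_cases h' : a = (J, true) <;> simp [toShift, exponentSum, h, h']
  exact DFunLike.congr_fun this w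

theorem not_partialInter_fg {J : NonemptySubset k} (hJ : c J = 1) :
    ¬ (partialInter c.member J).FG := by
  intro hfg
  let Ψ : c.Ambient →* FreeGroup ℤ ⋊[shiftAction] Multiplicative ℤ :=
    (toShift J).comp (MonoidHom.fst _ _)
  have himage : (partialInter c.member J).map Ψ =
      (SemidirectProduct.inl : FreeGroup ℤ →* FreeGroup ℤ ⋊[shiftAction] Multiplicative ℤ).range := by
    apply le_antisymm
    · rintro _ ⟨p, hp, rfl⟩
      rw [SemidirectProduct.range_inl_eq_ker_rightHom, MonoidHom.mem_ker]
      exact (rightHom_toShift J p.1).trans (c.exponentSum_eq_one_of_mem_partialInter hJ hp)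
    · rw [MonoidHom.range_eq_map, ← FreeGroup.closure_range_of, MonoidHom.map_closure,
        Subgroup.closure_le]
      rintro _ ⟨_, ⟨z, rfl⟩, rfl⟩
      refine ⟨_, c.conj_mem_partialInter J z, ?_⟩
      rw [← inr_zpow_conj_inl z]
      simp [Ψ, toShift]
  have : Group.FG (partialInter c.member J) := (Group.fg_iff_subgroup_fg _).2 hfg
  have hrange := Group.fg_of_surjective (Ψ.subgroupMap_surjective (partialInter c.member J))
  rw [himage] at hrange
  let e := MonoidHom.ofInjective (f := (SemidirectProduct.inl :
    FreeGroup ℤ →* FreeGroup ℤ ⋊[shiftAction] Multiplicative ℤ)) SemidirectProduct.inl_injective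
  exact not_fg_freeGroup_of_infinite ℤ
    (Group.fg_of_surjective (f := e.symm.toMonoidHom) e.symm.surjective)

theorem isRealizable_ambient : c.IsRealizable c.Ambient := by
  refine ⟨c.member, intersectionConfiguration_eq_iff.2 fun J => ⟨fun h => ?_, c.partialInter_fg⟩⟩
  by_contra h0
  exact c.not_partialInter_fg (by omega) h

theorem isRealizable_freeTimesFreeAbelian {n m : ℕ} (hn : 2 ≤ n) (hm : c.supportRank ≤ m) :
    c.IsRealizable (FreeTimesFreeAbelian n m) := by
  obtain ⟨f, hf⟩ := exists_injective_freeGroup_hom (Letter k) hn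
  have hcard : Fintype.card c.coordinates ≤ Fintype.card (Fin m) := by
    simpa [c.card_coordinates] using hm
  obtain ⟨e⟩ := Function.Embedding.nonempty_of_card_le hcard
  let g : Multiplicative (c.coordinates → ℤ) →* Multiplicative (Fin m → ℤ) :=
    (Function.ExtendByZero.linearMap ℤ e).toAddMonoidHom.toMultiplicative
  have hg : Function.Injective g := fun v w h =>
    Function.extend_injective e.injective 0 h
  exact c.isRealizable_ambient.of_injective (f := f.prodMap g) (hf.prodMap hg)

end Configuration

theorem mainTheorem2 (k : ℕ) (hk : 1 ≤ k) (c : Configuration k) :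
    (∀ n m : ℕ, 2 ≤ n → Configuration.supportRank c ≤ m →
      Configuration.IsRealizable c (FreeTimesFreeAbelian n m)) ∧
    (∀ n : ℕ, 2 ≤ n →
      ∃ H : Fin k → Subgroup (FreeTimesFreeAbelian n (Configuration.supportRank c)),
        ∀ I : NonemptySubset k, (partialInter H I).FG ↔ c I = 0) := by
  refine ⟨fun n m hn hm => c.isRealizable_freeTimesFreeAbelian hn hm, fun n hn => ?_⟩
  obtain ⟨H, hH⟩ := c.isRealizable_freeTimesFreeAbelian hn le_rfl
  exact ⟨H, intersectionConfiguration_eq_iff.1 hH⟩
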